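/- All graphs are simple. A split of a graph $H$ is a partition $(X,Y)$ of $V(H)$ with $|X|,|Y|\ge 2$ such that every vertex of $X$ with a neighbour in $Y$ is adjacent to every vertex of $Y$ with a neighbour in $X$. A connected graph without a split is called prime. A marked graph is a connected graph $D$ with a set $M(D)$ of marked edges that form a matching and are all cut-edges; its bags are the connected components of $(V(D),E(D)\setminus M(D))$. The simple decomposition of a graph $H$ given by a split $(X,Y)$ of $H$ is obtained from $H$ by deleting the edges between $X$ and $Y$ and adding two new vertices $x',y'$, a marked edge $x'y'$, all edges $x'x$ with $x\in X$ having a neighbour in $Y$, and all edges $y'y$ with $y\in Y$ having a neighbour in $X$. A split decomposition of a connected graph $G$ is a marked graph obtained from $G$ (without marked edges) by finitely many, possibly zero, steps, each replacing a bag by a simple decomposition of it; the vertices of $G$ are thus vertices of $D$. If $D$ is obtained from a split decomposition $D_0$ of $G$ by at least one such step, then $D$ is called a refinement of $D_0$. A canonical decomposition $D_G$ of $G$ (it is unique up to isomorphism when $G$ is finite) is a split decomposition of $G$ each of whose bags is a prime graph, a star or a complete graph, and which is not a refinement of a split decomposition of $G$ with the same property. Lemma. Let $G$ be a connected graph, let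 $D_G$ be a canonical decomposition of $G$, and let $v\in V(G)$ be the centre of a bag of $D_G$ that is a star $K_{1,n}$ with $n\ge 2$. Then $v$ is a cut-vertex of $G$, that is, the subgraph of $G$ induced by $V(G)\setminus\{v\}$ has more than one connected component. -/

import Mathlib

universe u

namespace SplitDecomp

open SimpleGraph

/-- `(X, Y)` is a split of `H`: a partition of the vertex set into two sides with at least two
vertices each, such that every vertex of `N(X)` (in `Y`, with a neighbour in `X`) is adjacent to
every vertex of `N(Y)` (in `X`, with a neighbour in `Y`). -/
structure IsSplit {U : Type u} (H : SimpleGraph U) (X Y : Set U) : Prop where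
  union_eq : X ∪ Y = Set.univ
  disjoint : Disjoint X Y
  two_le_left : 2 ≤ X.encard
  two_le_right : 2 ≤ Y.encard
  adj : ∀ x ∈ X, ∀ y ∈ Y, (∃ y' ∈ Y, H.Adj x y') → (∃ x' ∈ X, H.Adj x' y) → H.Adj x y

/-- A prime graph: a connected graph without a split. -/
def IsPrimeGraph {U : Type u} (H : SimpleGraph U) : Prop :=
  H.Connected ∧ ¬ ∃ X Y : Set U, IsSplit H X Y

/-- `H` is a star with at least three vertices (that is, with at least two leaves, so that its
centre is well defined) and `c` is its centre. -/
def IsStarWithCenter {U : Type u} (H : SimpleGraph U) (c : U) : Prop :=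
  3 ≤ ENat.card U ∧ H = starGraph c

/-- `v` is a cut-vertex of `G`: the subgraph induced by the other vertices has more than one
connected component. -/
def IsCutVertex {V : Type u} (G : SimpleGraph V) (v : V) : Prop :=
  Nontrivial (G.induce {v}ᶜ).ConnectedComponent

/-- A marked graph: a connected graph with a set of marked edges that form a matching and are
all cut-edges. It comes with an embedding `label` of a type `V`, which in a split decomposition
of a graph on `V` identifies `V` with the set of unmarked vertices. -/
structure MarkedGraph (V : Type u) where
  /-- the vertices of the marked graph -/
  Vert : Type u
  graph : SimpleGraph Vert
  connected : graph.Connected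
  marked : Set (Sym2 Vert)
  marked_subset : marked ⊆ graph.edgeSet
  matching : ∀ e ∈ marked, ∀ e' ∈ marked, ∀ w, w ∈ e → w ∈ e' → e = e'
  cut_edge : ∀ e ∈ marked, graph.IsBridge e
  label : V ↪ Vert

namespace MarkedGraph

variable {V : Type u}

/-- The graph obtained by deleting the marked edges. -/
def unmarkedGraph (D : MarkedGraph V) : SimpleGraph D.Vert :=
  D.graph.deleteEdges D.marked

/-- The bags are the connected components left after deleting the marked edges. -/
abbrev Bag (D : MarkedGraph V) : Type u := D.unmarkedGraph.ConnectedComponent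

/-- A bag, as a graph on its own vertex set. -/
abbrev bagGraph (D : MarkedGraph V) (B : D.Bag) : SimpleGraph B.supp :=
  D.unmarkedGraph.induce B.supp

/-- `D` is the graph `G` itself, without marked edges. -/
structure IsWhole (G : SimpleGraph V) (D : MarkedGraph V) : Prop where
  bijective : Function.Bijective D.label
  adj_iff : ∀ u v, D.graph.Adj (D.label u) (D.label v) ↔ G.Adj u v
  marked_eq : D.marked = ∅

/-- `D` arises from `D₀` by replacing one bag `B` by the simple decomposition of `B` given by a
split `(X, Y)` of `B`. The vertices of `D` are those of `D₀`, embedded by `f`, and two new ones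
`x'` and `y'`. The edges between `X` and `Y` disappear, `x'` is joined to the vertices of `X` with
a neighbour in `Y`, `y'` to the vertices of `Y` with a neighbour in `X`, and `x'y'` is a new
marked edge. All other edges, marks and labels are kept. -/
def Step (D₀ D : MarkedGraph V) : Prop :=
  ∃ (B : D₀.Bag) (X Y : Set B.supp) (f : D₀.Vert ↪ D.Vert) (x' y' : D.Vert),
    IsSplit (D₀.bagGraph B) X Y ∧
    x' ≠ y' ∧ x' ∉ Set.range f ∧ y' ∉ Set.range f ∧
    (∀ w, w ∈ Set.range f ∨ w = x' ∨ w = y') ∧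
    (∀ v, D.label v = f (D₀.label v)) ∧
    D.marked = Sym2.map f '' D₀.marked ∪ {s(x', y')} ∧
    (∀ a b : D₀.Vert, D.graph.Adj (f a) (f b) ↔
      D₀.graph.Adj a b ∧
        ¬ (a ∈ Subtype.val '' X ∧ b ∈ Subtype.val '' Y) ∧
        ¬ (a ∈ Subtype.val '' Y ∧ b ∈ Subtype.val '' X)) ∧
    (∀ a : D₀.Vert, D.graph.Adj x' (f a) ↔
      ∃ x ∈ X, x.val = a ∧ ∃ y ∈ Y, (D₀.bagGraph B).Adj x y) ∧
    (∀ a : D₀.Vert, D.graph.Adj y' (f a) ↔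
      ∃ y ∈ Y, y.val = a ∧ ∃ x ∈ X, (D₀.bagGraph B).Adj x y)

/-- `D` is a split decomposition of `G`: it is `G`, or it is obtained from `G` by successively
replacing bags by simple decompositions. -/
def IsSplitDecomposition (G : SimpleGraph V) (D : MarkedGraph V) : Prop :=
  ∃ D₀ : MarkedGraph V, D₀.IsWhole G ∧ Relation.ReflTransGen Step D₀ D

/-- `D` is a (proper) refinement of `D₀`: it is obtained from `D₀` by replacing bags by simple
decompositions, at least once. -/
def IsRefinement (D₀ D : MarkedGraph V) : Prop :=
  Relation.TransGen Step D₀ D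

/-- Every bag is a prime graph, a star or a complete graph. (A star with one or two vertices is a
complete graph.) -/
def HasGoodBags (D : MarkedGraph V) : Prop :=
  ∀ B : D.Bag, IsPrimeGraph (D.bagGraph B) ∨ (∃ c, IsStarWithCenter (D.bagGraph B) c) ∨
    D.bagGraph B = ⊤

/-- `D` is a canonical decomposition of `G`: each bag is prime, a star or complete, and `D` is
not a refinement of another split decomposition of `G` with this property. -/
def IsCanonicalDecomposition (G : SimpleGraph V) (D : MarkedGraph V) : Prop :=
  D.IsSplitDecomposition G ∧ D.HasGoodBags ∧
    ¬ ∃ D₀ : MarkedGraph V, D₀.IsSplitDecomposition G ∧ D₀.HasGoodBags ∧ D₀.IsRefinement D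

end MarkedGraph

end SplitDecomp

namespace SplitDecomp

open SimpleGraph

/-! Two facts carry the proof. In the marked graph, two leaves of a star bag are separated by its
centre, because marked edges are bridges and so no path can leave the bag and come back
(`isCutVertex_of_isStarWithCenter`). Undoing a decomposition step keeps an old vertex a cut-vertex
(`Step.isCutVertex_label`): contrapositively, a path avoiding it survives the step once each deleted
edge `xy` is rerouted as `x x' y' y`. Induction back along the steps reaches `G`. -/

theorem isCutVertex_iff_not_preconnected {V : Type u} (G : SimpleGraph V) (v : V) :
    IsCutVertex G v ↔ ¬ (G.induce {v}ᶜ).Preconnected := by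
  rw [IsCutVertex, ← not_subsingleton_iff_nontrivial, not_iff_not]
  exact ⟨fun h a b ↦ ConnectedComponent.exact (h.elim _ _),
    fun h ↦ h.subsingleton_connectedComponent⟩

theorem IsCutVertex.of_isWhole {V : Type u} {G : SimpleGraph V} {D : MarkedGraph V}
    (h : D.IsWhole G) {v : V} (hv : IsCutVertex D.graph (D.label v)) : IsCutVertex G v := by
  rw [isCutVertex_iff_not_preconnected] at hv ⊢
  contrapose! hv
  let φ : G.induce {v}ᶜ →g D.graph.induce {D.label v}ᶜ :=
    { toFun := fun a ↦ ⟨D.label a, fun e ↦ a.2 (D.label.injective e)⟩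
      map_rel' := fun {a b} hab ↦ (h.adj_iff a b).2 hab }
  rintro ⟨a, ha⟩ ⟨b, hb⟩
  obtain ⟨a, rfl⟩ := h.bijective.2 a
  obtain ⟨b, rfl⟩ := h.bijective.2 b
  exact (hv ⟨a, fun e ↦ ha (congrArg D.label e)⟩ ⟨b, fun e ↦ hb (congrArg D.label e)⟩).map φ

namespace MarkedGraph

variable {V : Type u}

/-- A marked edge is a bridge, so its ends lie in different bags. -/
theorem adj_unmarkedGraph_of_reachable (D : MarkedGraph V) {a b : D.Vert} (hab : D.graph.Adj a b)
    (h : D.unmarkedGraph.Reachable a b) : D.unmarkedGraph.Adj a b := by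
  refine (deleteEdges_adj).2 ⟨hab, fun hm ↦ ?_⟩
  exact isBridge_iff.1 (D.cut_edge _ hm)
    (h.mono (deleteEdges_anti (Set.singleton_subset_iff.2 hm)))

theorem adj_bagGraph (D : MarkedGraph V) {B : D.Bag} {a b : B.supp}
    (hab : D.graph.Adj a b) : (D.bagGraph B).Adj a b :=
  D.adj_unmarkedGraph_of_reachable hab (ConnectedComponent.exact (a.2.trans b.2.symm))

/-- A bag is connected, so a walk from `X` to `Y` must cross. The crossing edge ties the new marked
edge to the old vertices. -/
theorem exists_adj_of_isSplit (D : MarkedGraph V) {B : D.Bag} {X Y : Set B.supp}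
    (h : IsSplit (D.bagGraph B) X Y) : ∃ x ∈ X, ∃ y ∈ Y, (D.bagGraph B).Adj x y := by
  obtain ⟨a, ha⟩ : X.Nonempty := by
    rw [← Set.encard_pos]; exact lt_of_lt_of_le (by norm_num) h.two_le_left
  obtain ⟨b, hb⟩ : Y.Nonempty := by
    rw [← Set.encard_pos]; exact lt_of_lt_of_le (by norm_num) h.two_le_right
  have hc : (D.bagGraph B).Connected := B.connected_toSimpleGraph
  obtain ⟨p⟩ := hc.preconnected a b
  obtain ⟨d, -, hd, hd'⟩ := p.exists_boundary_dart X ha (Set.disjoint_right.1 h.disjoint hb)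
  have : d.snd ∈ X ∪ Y := h.union_eq ▸ Set.mem_univ _
  exact ⟨d.fst, hd, d.snd, this.resolve_left hd', d.adj⟩

/-- Replacing a bag by a simple decomposition creates no cut-vertex among the old vertices. -/
theorem Step.isCutVertex_label {D₀ D : MarkedGraph V} (h : Step D₀ D) {v : V}
    (hv : IsCutVertex D.graph (D.label v)) : IsCutVertex D₀.graph (D₀.label v) := by
  obtain ⟨B, X, Y, f, x', y', hs, -, hx', hy', hcov, hlab, hmark, hadj, hxa, hya⟩ := h
  rw [hlab] at hv
  generalize D₀.label v = c at hv
  rw [isCutVertex_iff_not_preconnected] at hv ⊢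
  contrapose! hv
  let g : ({c}ᶜ : Set D₀.Vert) → ({f c}ᶜ : Set D.Vert) :=
    fun a ↦ ⟨f a, fun e ↦ a.2 (f.injective e)⟩
  let x'' : ({f c}ᶜ : Set D.Vert) := ⟨x', fun e ↦ hx' ⟨c, e.symm⟩⟩
  let y'' : ({f c}ᶜ : Set D.Vert) := ⟨y', fun e ↦ hy' ⟨c, e.symm⟩⟩
  have hxy : D.graph.Adj x' y' := D.marked_subset (by rw [hmark]; exact Or.inr rfl)
  have rxy : (D.graph.induce {f c}ᶜ).Reachable x'' y'' :=
    Adj.reachable (G := D.graph.induce {f c}ᶜ) (u := x'') (v := y'') hxy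
  have rx : ∀ a : ({c}ᶜ : Set D₀.Vert), ∀ x ∈ X, ∀ y ∈ Y, x.val = a → (D₀.bagGraph B).Adj x y →
      (D.graph.induce {f c}ᶜ).Reachable x'' (g a) := fun a x hx y hy e hab ↦
    Adj.reachable (G := D.graph.induce {f c}ᶜ) (u := x'') (v := g a)
      ((hxa a).2 ⟨x, hx, e, y, hy, hab⟩)
  have ry : ∀ a : ({c}ᶜ : Set D₀.Vert), ∀ x ∈ X, ∀ y ∈ Y, y.val = a → (D₀.bagGraph B).Adj x y →
      (D.graph.induce {f c}ᶜ).Reachable y'' (g a) := fun a x hx y hy e hab ↦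
    Adj.reachable (G := D.graph.induce {f c}ᶜ) (u := y'') (v := g a)
      ((hya a).2 ⟨y, hy, e, x, hx, hab⟩)
  have step : ∀ a b : ({c}ᶜ : Set D₀.Vert), (D₀.graph.induce {c}ᶜ).Adj a b →
      (D.graph.induce {f c}ᶜ).Reachable (g a) (g b) := by
    intro a b hab
    have hab' : D₀.graph.Adj a b := hab
    -- An edge deleted by the step is replaced by the detour through `x'` and `y'`, neither of which
    -- is `f c`.
    by_cases h₁ : a.1 ∈ Subtype.val '' X ∧ b.1 ∈ Subtype.val '' Y
    · obtain ⟨⟨x, hx, ex⟩, y, hy, ey⟩ := h₁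
      have hxy : (D₀.bagGraph B).Adj x y := D₀.adj_bagGraph (by rwa [ex, ey])
      exact ((rx a x hx y hy ex hxy).symm.trans rxy).trans (ry b x hx y hy ey hxy)
    by_cases h₂ : a.1 ∈ Subtype.val '' Y ∧ b.1 ∈ Subtype.val '' X
    · obtain ⟨⟨y, hy, ey⟩, x, hx, ex⟩ := h₂
      have hxy : (D₀.bagGraph B).Adj x y := D₀.adj_bagGraph (by rw [ex, ey]; exact hab'.symm)
      exact ((ry a x hx y hy ey hxy).symm.trans rxy.symm).trans (rx b x hx y hy ex hxy)
    exact Adj.reachable (G := D.graph.induce {f c}ᶜ) (u := g a) (v := g b)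
      ((hadj a b).2 ⟨hab', h₁, h₂⟩)
  have old : ∀ a b, (D.graph.induce {f c}ᶜ).Reachable (g a) (g b) := by
    intro a b
    obtain ⟨p⟩ := hv a b
    induction p with
    | nil => rfl
    | cons hab _ ih => exact (step _ _ hab).trans ih
  -- At most one end of a crossing edge is `c`; the other end links the new vertices to the old
  -- ones.
  obtain ⟨a, hxa'⟩ : ∃ a, (D.graph.induce {f c}ᶜ).Reachable x'' (g a) := by
    obtain ⟨x, hx, y, hy, hab⟩ := D₀.exists_adj_of_isSplit hs
    by_cases hxc : x.val = c
    · have hyc : y.val ≠ c := fun e ↦ hab.ne (Subtype.ext (hxc.trans e.symm))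
      exact ⟨⟨y, hyc⟩, rxy.trans (ry _ x hx y hy rfl hab)⟩
    · exact ⟨⟨x, hxc⟩, rx _ x hx y hy rfl hab⟩
  have all : ∀ w, (D.graph.induce {f c}ᶜ).Reachable x'' w := by
    rintro ⟨w, hw⟩
    rcases hcov w with ⟨b, rfl⟩ | rfl | rfl
    · exact hxa'.trans (old a ⟨b, fun e ↦ hw (congrArg f e)⟩)
    · rfl
    · exact rxy
  exact fun u w ↦ (all u).symm.trans (all w)

theorem IsSplitDecomposition.isCutVertex {G : SimpleGraph V} {D : MarkedGraph V}
    (h : D.IsSplitDecomposition G) {v : V} (hv : IsCutVertex D.graph (D.label v)) :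
    IsCutVertex G v := by
  obtain ⟨D₀, h₀, hD⟩ := h
  refine IsCutVertex.of_isWhole h₀ ?_
  induction hD with
  | refl => exact hv
  | tail _ hs ih => exact ih (hs.isCutVertex_label hv)

/-- The centre of a star bag is a cut-vertex of the marked graph. -/
theorem isCutVertex_of_isStarWithCenter (D : MarkedGraph V) (B : D.Bag) (c : B.supp)
    (hB : IsStarWithCenter (D.bagGraph B) c) : IsCutVertex D.graph c := by
  obtain ⟨hcard, hstar⟩ := hB
  have hadj : ∀ a b : B.supp, D.unmarkedGraph.Adj a b ↔ a ≠ b ∧ (a = c ∨ b = c) := by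
    intro a b
    rw [← starGraph_adj, ← hstar]
    rfl
  obtain ⟨a, hac, -⟩ := ENat.exists_ne_ne_of_three_le hcard c c
  obtain ⟨b, hbc, hba⟩ := ENat.exists_ne_ne_of_three_le hcard c a
  rw [isCutVertex_iff_not_preconnected]
  intro hpre
  obtain ⟨a', ha'⟩ : ∃ a' : ({c.val}ᶜ : Set D.Vert), a'.val = a :=
    ⟨⟨a, fun e ↦ hac (Subtype.ext e)⟩, rfl⟩
  obtain ⟨b', hb'⟩ : ∃ b' : ({c.val}ᶜ : Set D.Vert), b'.val = b :=
    ⟨⟨b, fun e ↦ hbc (Subtype.ext e)⟩, rfl⟩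
  obtain ⟨q, hq⟩ := (hpre a' b').exists_isPath
  cases q with
  | nil => exact hba (Subtype.ext (hb'.symm.trans ha'))
  | @cons _ w _ haw q =>
    rw [Walk.cons_isPath_iff] at hq
    have haw' : D.graph.Adj a w := ha' ▸ haw
    -- If the first edge of the path is marked, it lies on a closed walk through `c` and `b` that
    -- uses it only once, so it is no bridge.
    by_cases hm : s((a : D.Vert), (w : D.Vert)) ∈ D.marked
    · have hle : D.unmarkedGraph ≤ D.graph.deleteEdges {s((a : D.Vert), (w : D.Vert))} :=
        deleteEdges_anti (Set.singleton_subset_iff.2 hm)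
      have hab : (D.graph.deleteEdges {s((a : D.Vert), (w : D.Vert))}).Reachable a b :=
        (((hadj a c).2 ⟨hac, Or.inr rfl⟩).reachable.trans
          ((hadj c b).2 ⟨hbc.symm, Or.inl rfl⟩).reachable).mono hle
      let φ : D.graph.induce {c.val}ᶜ →g D.graph := (Embedding.induce _).toHom
      -- The rest of the path never returns to `a`, hence avoids this edge.
      have hr : s((a : D.Vert), (w : D.Vert)) ∉ (q.map φ).edges := by
        intro he
        have hs : (a : D.Vert) ∈ (q.map φ).support := Walk.fst_mem_support_of_mem_edges _ he
        rw [Walk.support_map, List.mem_map] at hs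
        obtain ⟨z, hz, hza⟩ := hs
        exact hq.2 ((Subtype.ext (hza.trans ha'.symm) : z = a') ▸ hz)
      have hwb : (D.graph.deleteEdges {s((a : D.Vert), (w : D.Vert))}).Reachable w b' :=
        ((q.map φ).toDeleteEdge _ hr).reachable
      exact isBridge_iff.1 (D.cut_edge _ hm) (hab.trans (hb' ▸ hwb).symm)
    -- If it is unmarked, `w` stays in the bag, where the only neighbour of the leaf `a` is the
    -- forbidden centre `c`.
    · have hun : D.unmarkedGraph.Adj a w := deleteEdges_adj.2 ⟨haw', hm⟩
      have hwB : (w : D.Vert) ∈ B.supp :=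
        (ConnectedComponent.sound hun.reachable.symm).trans a.2
      rcases ((hadj a ⟨w, hwB⟩).1 hun).2 with e | e
      · exact hac e
      · exact w.2 (congrArg Subtype.val e)

end MarkedGraph

end SplitDecomp

theorem mainTheorem7 {V : Type u} (G : SimpleGraph V) (D : SplitDecomp.MarkedGraph V)
    (hD : D.IsCanonicalDecomposition G) (v : V) (B : D.Bag) (hv : D.label v ∈ B.supp)
    (hB : SplitDecomp.IsStarWithCenter (D.bagGraph B) ⟨D.label v, hv⟩) :
    SplitDecomp.IsCutVertex G v :=
  hD.1.isCutVertex (D.isCutVertex_of_isStarWithCenter B ⟨D.label v, hv⟩ hB)
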